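/- Let a random tree evolve in continuous time from a single living node (the root) born at time $0$: every living node has an exponentially distributed lifetime with parameter $Q>0$; at the end of its life it dies and at that moment produces $\nu$ new living nodes, its children, where $\mathcal P\{\nu=j\}=f_j$ for $j=0,1,2$, $f_0+f_1+f_2=1$ and $f_2>0$. All lifetimes and all offspring numbers are independent. Let $q(z)=f_0+f_1z+f_2z^2$, $q_1=q'(1)$, $q_2=q''(1)$, and let $\mu(t)$ be the total number of nodes, living or dead, present at time $t$. Then: 1. For every integer $n\ge 1$ the limit $p_n=\lim_{t\to\infty}\mathcal P\{\mu(t)=n\}$ exists. 2. For all real $z\neq 0$ with $|z|\le 1$ we have $(1-q_1z)^2+2q_2z(1-z)\ge 0$, the series $\sum_{n\ge1}p_nz^n$ converges, and $$\sum_{n=1}^{\infty}p_nz^n=g(z):=1+\frac{1}{q_2z}\left[1-q_1z-\sqrt{(1-q_1z)^2+2q_2z(1-z)}\,\right],$$ and $g(z)=z\,q(g(z))$. 3. $\lim_{z\to0}g(z)=0$; moreover $g(1)=1$ if $q_1\le 1$, and $g(1)=1-2(q_1-1)/q_2$ if $q_1>1$. 4. For every $n\ge1$, $$p_n=\frac{1}{q_2}\left[\frac{1}{2\sqrt\pi}\,\frac{\Gamma(n+1/2)}{\Gamma(n+2)}\left(U^{n+1}+V^{n+1}\right)-W_{n+1}\right],$$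 where $$U=q_1-q_2+\sqrt{2q_2}\sqrt{1-q_1+\tfrac12q_2},\qquad V=q_1-q_2-\sqrt{2q_2}\sqrt{1-q_1+\tfrac12q_2},$$ $$W_{n+1}=\frac1{4\pi}\sum_{j=1}^{n}\frac{\Gamma(j-1/2)}{\Gamma(j+1)}\,\frac{\Gamma(n-j+1/2)}{\Gamma(n-j+2)}\,U^jV^{n+1-j}.$$ 5. $\sum_{n=1}^{\infty}p_n=1$ if $q_1\le1$, and $\sum_{n=1}^{\infty}p_n=1-2(q_1-1)/q_2$ if $q_1>1$. -/

import Mathlib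

open Filter Topology MeasureTheory ProbabilityTheory

noncomputable section

namespace RandomTree

/-! Nodes are labelled by finite lists of naturals: `[]` is the root, and `i :: v` is the node that
has label `v` in the subtree generated by the `i`-th child of the root (children are numbered
`0, 1, …`). To each label `u` belong a lifetime `τ u` and an offspring number `ν u`. -/

/-- The node with the given label is ever produced: at each step the index of the child is smaller
than the offspring number of its parent. -/
def IsProduced : (List ℕ → ℕ) → List ℕ → Prop
  | _, [] => True
  | ν, i :: v => i < ν [] ∧ IsProduced (fun w => ν (i :: w)) v

/-- The birth time of a node: the root is born at time `0`, and the children of a node are born at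
the moment of its death, so this is the sum of the lifetimes of the strict ancestors. -/
def birthTime : (List ℕ → ℝ) → List ℕ → ℝ
  | _, [] => 0
  | τ, i :: v => τ [] + birthTime (fun w => τ (i :: w)) v

/-- The tree size at time `t`: the total number of nodes, living or dead, produced up to `t`. -/
def treeSize (τ : List ℕ → ℝ) (ν : List ℕ → ℕ) (t : ℝ) : ℕ∞ :=
  {u : List ℕ | IsProduced ν u ∧ birthTime τ u ≤ t}.encard

/-- The random variables driving the evolution of a tree on the probability space `(Ω, P)`:
all lifetimes and offspring numbers are independent, every lifetime is exponential with parameter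
`Q`, and every offspring number has the law `f`. -/
structure IsEvolution {Ω : Type*} [MeasurableSpace Ω] (P : Measure Ω) (Q : ℝ) (f : PMF ℕ)
    (τ : List ℕ → Ω → ℝ) (ν : List ℕ → Ω → ℕ) : Prop where
  measurable_lifetime : ∀ u, Measurable (τ u)
  measurable_offspring : ∀ u, Measurable (ν u)
  map_lifetime : ∀ u, P.map (τ u) = expMeasure Q
  map_offspring : ∀ u, P.map (ν u) = f.toMeasure
  indep_lifetime_offspring : ∀ u, IndepFun (τ u) (ν u) P
  indep_nodes : iIndepFun (fun u ω => (τ u ω, ν u ω)) P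

/-- The probability generating function `q(z) = E[z^ν] = ∑ fₙ zⁿ`. -/
def genFun (f : PMF ℕ) (z : ℝ) : ℝ := ∑' n : ℕ, (f n).toReal * z ^ n

/-- The factorial moments `q_j = q^{(j)}(1)`. (Used below only for laws of finite support, where
`q` is a polynomial.) -/
def factorialMoment (f : PMF ℕ) (j : ℕ) : ℝ := iteratedDeriv j (genFun f) 1

/-- The generating function `g` of the stationary tree size, for `z ≠ 0`. -/
def sizeGF (q₁ q₂ z : ℝ) : ℝ :=
  1 + (1 - q₁ * z - √((1 - q₁ * z) ^ 2 + 2 * q₂ * z * (1 - z))) / (q₂ * z)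

def U (q₁ q₂ : ℝ) : ℝ := q₁ - q₂ + √(2 * q₂) * √(1 - q₁ + q₂ / 2)

def V (q₁ q₂ : ℝ) : ℝ := q₁ - q₂ - √(2 * q₂) * √(1 - q₁ + q₂ / 2)

/-- The quantity written `W_{n+1}`. -/
def W (q₁ q₂ : ℝ) (n : ℕ) : ℝ :=
  1 / (4 * Real.pi) * ∑ j ∈ Finset.Icc 1 n,
    Real.Gamma ((j : ℝ) - 1 / 2) / Real.Gamma ((j : ℝ) + 1) *
      (Real.Gamma ((n : ℝ) - j + 1 / 2) / Real.Gamma ((n : ℝ) - j + 2)) *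
      U q₁ q₂ ^ j * V q₁ q₂ ^ (n + 1 - j)

end RandomTree

end

/-! Every produced node has a finite birth time, so as `t → ∞` the tree size increases to the total
progeny N. An infinite progeny contains n + 1 nodes born by some finite time, so each event "size =
n" stabilises pointwise, and p_n = P(N = n) depends on the offspring law alone
(`tendsto_prob_treeSize`).

Write a, b, c for f₀, f₁, f₂. The subtrees of the children are independent copies of the tree, so
splitting on the root's offspring gives a quadratic recursion (`progenyProb_succ`), that is, G = z(a
+ bG + cG²). Completing the square, B = 1 - bz - 2czG satisfies B² = (1 - bz)² - 4acz² = (1 - Uz)(1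
- Vz), with U, V = b ± 2√(ac). This is used twice. As formal series, B = √(1 - UX)·√(1 - VX), whose
coefficients are the Gamma quotients (`coeff_formal_solution`). As functions on [-1, 1], B is the
nonnegative square root by continuity from B(0) = 1 (`sqrt_discriminant_eq`). At z = 1 the root is
|1 - q₁|, whence the two cases for the mass. -/

noncomputable section

namespace RandomTree

/-! ### Total progeny: decomposition at the root and measurability -/

/-- The total number of nodes ever produced. -/
def totalProgeny (ν : List ℕ → ℕ) : ℕ∞ := {u : List ℕ | IsProduced ν u}.encard

/-- The law of the total progeny. -/
def progenyProb (f : PMF ℕ) (n : ℕ) : ℝ :=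
  (Measure.infinitePi (fun _ : List ℕ => f.toMeasure)).real {x | totalProgeny x = n}

theorem setOf_isProduced (x : List ℕ → ℕ) :
    {u : List ℕ | IsProduced x u} =
      insert [] (⋃ i ∈ Finset.range (x []),
        (List.cons i) '' {u | IsProduced (fun w => x (i :: w)) u}) := by
  ext u
  cases u with
  | nil => simp [IsProduced]
  | cons i v => simp [IsProduced, and_comm]

theorem totalProgeny_of_zero {x : List ℕ → ℕ} (h : x [] = 0) : totalProgeny x = 1 := by
  rw [totalProgeny, setOf_isProduced, h]; simp

theorem totalProgeny_of_one {x : List ℕ → ℕ} (h : x [] = 1) :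
    totalProgeny x = totalProgeny (fun w => x (0 :: w)) + 1 := by
  rw [totalProgeny, setOf_isProduced, h]
  simp only [Finset.range_one, Finset.mem_singleton, Set.iUnion_iUnion_eq_left]
  rw [Set.encard_insert_of_notMem (by simp), (List.cons_injective).encard_image]
  rfl

theorem totalProgeny_of_two {x : List ℕ → ℕ} (h : x [] = 2) :
    totalProgeny x =
      totalProgeny (fun w => x (0 :: w)) + totalProgeny (fun w => x (1 :: w)) + 1 := by
  have hU : (⋃ i ∈ Finset.range 2, (List.cons i) '' {u | IsProduced (fun w => x (i :: w)) u}) =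
      (List.cons 0) '' {u | IsProduced (fun w => x (0 :: w)) u} ∪
        (List.cons 1) '' {u | IsProduced (fun w => x (1 :: w)) u} := by
    ext u
    simp only [Finset.mem_range, Set.mem_iUnion, Set.mem_union, exists_prop]
    constructor
    · rintro ⟨i, hi, hu⟩
      interval_cases i
      · exact Or.inl hu
      · exact Or.inr hu
    · rintro (hu | hu)
      · exact ⟨0, by norm_num, hu⟩
      · exact ⟨1, by norm_num, hu⟩
  rw [totalProgeny, setOf_isProduced, h, hU, Set.encard_insert_of_notMem (by simp),
    Set.encard_union_eq, (List.cons_injective).encard_image, (List.cons_injective).encard_image]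
  · rfl
  · rw [Set.disjoint_left]
    rintro _ ⟨u, -, rfl⟩ ⟨v, -, hv⟩
    simp at hv

theorem totalProgeny_ne_zero (x : List ℕ → ℕ) : totalProgeny x ≠ 0 := by
  rw [totalProgeny, Set.encard_ne_zero]
  exact ⟨[], trivial⟩

theorem measurableSet_isProduced (u : List ℕ) :
    MeasurableSet {x : List ℕ → ℕ | IsProduced x u} := by
  induction u with
  | nil => simp [IsProduced]
  | cons i v ih =>
    have h₁ : MeasurableSet {x : List ℕ → ℕ | i < x []} :=
      measurableSet_lt measurable_const (measurable_pi_apply _)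
    have h₂ : Measurable (fun (x : List ℕ → ℕ) (w : List ℕ) => x (i :: w)) := by fun_prop
    exact h₁.inter (h₂ ih)

theorem measurable_birthTime (u : List ℕ) :
    Measurable (fun x : List ℕ → ℝ => birthTime x u) := by
  induction u with
  | nil => exact measurable_const
  | cons i v ih =>
    have h₂ : Measurable (fun (x : List ℕ → ℝ) (w : List ℕ) => x (i :: w)) := by fun_prop
    exact (measurable_pi_apply _).add (ih.comp h₂)

/-- The events that a countable random set has a given finite size are measurable. -/
theorem measurableSet_encard_eq {Ω ι : Type*} [MeasurableSpace Ω] [Countable ι]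
    {S : Ω → Set ι} (hS : ∀ u, MeasurableSet {ω | u ∈ S ω}) (n : ℕ) :
    MeasurableSet {ω | (S ω).encard = n} := by
  -- There are only countably many finite subsets of a countable type, and being equal to a given
  -- one is a countable intersection of measurable conditions.
  have : {ω | (S ω).encard = n} =
      ⋃ F : Finset ι, ⋃ _ : F.card = n, ⋂ u, {ω | u ∈ S ω ↔ u ∈ F} := by
    ext ω
    simp only [Set.mem_ofPred_eq, Set.mem_iUnion, Set.mem_iInter, exists_prop]
    constructor
    · intro h
      have hfin : (S ω).Finite := Set.finite_of_encard_eq_coe h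
      refine ⟨hfin.toFinset, ?_, by simp⟩
      rw [hfin.encard_eq_coe_toFinset_card] at h
      exact_mod_cast h
    · rintro ⟨F, hF, h⟩
      have : S ω = F := by ext u; simp [h u]
      rw [this, Set.encard_coe_eq_coe_finsetCard, hF]
  rw [this]
  refine .iUnion fun F => .iUnion fun _ => .iInter fun u => ?_
  by_cases hu : u ∈ F
  · simpa [hu] using hS u
  · simp only [hu, iff_false]
    exact (hS u).compl

theorem measurableSet_totalProgeny_eq (n : ℕ) :
    MeasurableSet {x : List ℕ → ℕ | totalProgeny x = n} :=
  measurableSet_encard_eq (S := fun x => {u : List ℕ | IsProduced x u})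
    measurableSet_isProduced n

/-! ### Convergence of the tree size to the total progeny -/

theorem eventually_treeSize_eq_iff (τ : List ℕ → ℝ) (ν : List ℕ → ℕ) (n : ℕ) :
    ∀ᶠ t : ℝ in atTop, treeSize τ ν t = n ↔ totalProgeny ν = n := by
  have key : ∀ F : Finset (List ℕ), (∀ u ∈ F, IsProduced ν u) →
      ∀ᶠ t : ℝ in atTop, (F : Set (List ℕ)) ⊆ {u | IsProduced ν u ∧ birthTime τ u ≤ t} := by
    intro F hF
    have : ∀ᶠ t : ℝ in atTop, ∀ u ∈ F, birthTime τ u ≤ t :=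
      (Finset.eventually_all F).2 fun u _ => eventually_ge_atTop _
    filter_upwards [this] with t ht u hu
    exact ⟨hF u hu, ht u hu⟩
  have hle : ∀ t, treeSize τ ν t ≤ totalProgeny ν := fun t =>
    Set.encard_le_encard fun u hu => hu.1
  by_cases hfin : {u : List ℕ | IsProduced ν u}.Finite
  · filter_upwards [key hfin.toFinset (by simp)] with t ht
    have : treeSize τ ν t = totalProgeny ν :=
      (hle t).antisymm (Set.encard_le_encard (by simpa using ht))
    rw [this]
  -- Infinite progeny: once n + 1 of its nodes are born, both sides of the equivalence are false.
  · obtain ⟨F, hF, hc⟩ := Set.Infinite.exists_subset_card_eq hfin (n + 1)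
    filter_upwards [key F (fun u hu => hF hu)] with t ht
    have h1 : ((n + 1 : ℕ) : ℕ∞) ≤ treeSize τ ν t := by
      rw [← hc, ← Set.encard_coe_eq_coe_finsetCard]
      exact Set.encard_le_encard ht
    have h2 : (n : ℕ∞) < treeSize τ ν t :=
      lt_of_lt_of_le (by exact_mod_cast Nat.lt_succ_self n) h1
    exact iff_of_false h2.ne' (h2.trans_le (hle t)).ne'

theorem tendsto_prob_treeSize {Ω : Type*} [MeasurableSpace Ω] (P : Measure Ω)
    [IsProbabilityMeasure P] {Q : ℝ} {f : PMF ℕ} {τ : List ℕ → Ω → ℝ} {ν : List ℕ → Ω → ℕ}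
    (h : IsEvolution P Q f τ ν) (n : ℕ) :
    Tendsto (fun t : ℝ => P.real {ω | treeSize (τ · ω) (ν · ω) t = n})
      atTop (𝓝 (progenyProb f n)) := by
  have hν : Measurable (fun ω u => ν u ω) := measurable_pi_lambda _ h.measurable_offspring
  have hτ : Measurable (fun ω u => τ u ω) := measurable_pi_lambda _ h.measurable_lifetime
  have hind : iIndepFun ν P :=
    h.indep_nodes.comp (fun _ => Prod.snd) (fun _ => measurable_snd)
  -- Independence turns the joint law of the offspring numbers into a product measure, so the limit
  -- no longer refers to `Ω` or to the lifetimes.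
  have hlaw : P.map (fun ω u => ν u ω) = Measure.infinitePi (fun _ => f.toMeasure) := by
    rw [hind.map_fun_eq_infinitePi_map h.measurable_offspring]
    simp_rw [h.map_offspring]
  have hp : progenyProb f n = P.real {ω | totalProgeny (ν · ω) = n} := by
    rw [progenyProb, ← hlaw, map_measureReal_apply hν (measurableSet_totalProgeny_eq n)]
    rfl
  rw [hp]
  have hmeas : ∀ t : ℝ, MeasurableSet {ω | treeSize (τ · ω) (ν · ω) t = n} := fun t =>
    measurableSet_encard_eq
      (S := fun ω => {u | IsProduced (ν · ω) u ∧ birthTime (τ · ω) u ≤ t})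
      (fun u => (hν (measurableSet_isProduced u)).inter
        (measurableSet_le ((measurable_birthTime u).comp hτ) measurable_const)) n
  have key := tendsto_measure_of_tendsto_indicator_of_isFiniteMeasure atTop P hmeas
    (A := {ω | totalProgeny (ν · ω) = n}) (fun ω => eventually_treeSize_eq_iff (τ · ω) (ν · ω) n)
  exact (ENNReal.tendsto_toReal (measure_ne_top P _)).comp key

/-! ### The law of the total progeny and its recursion -/

variable (f : PMF ℕ)

theorem progenyProb_nonneg (n : ℕ) : 0 ≤ progenyProb f n := measureReal_nonneg

theorem progenyProb_zero : progenyProb f 0 = 0 := by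
  have : {x | totalProgeny x = ((0 : ℕ) : ℕ∞)} = ∅ := by
    ext x; simpa using totalProgeny_ne_zero x
  rw [progenyProb, this, measureReal_empty]

/-- The events are disjoint. Only an inequality holds, since the progeny may be infinite with
positive probability. -/
theorem sum_progenyProb_le_one (s : Finset ℕ) : ∑ n ∈ s, progenyProb f n ≤ 1 := by
  unfold progenyProb
  rw [← measureReal_biUnion_finset]
  · exact measureReal_le_one
  · intro i _ j _ hij
    rw [Function.onFun, Set.disjoint_left]
    intro x hi hj
    exact hij (by exact_mod_cast hi.symm.trans hj)
  · exact fun n _ => measurableSet_totalProgeny_eq n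

theorem summable_progenyProb : Summable (progenyProb f) :=
  summable_of_sum_le (progenyProb_nonneg f) (sum_progenyProb_le_one f)

theorem comap_reindex_le {ι γ X : Type*} [MeasurableSpace X] (c : γ → ι) :
    MeasurableSpace.comap (fun (x : ι → X) i => x (c i)) MeasurableSpace.pi ≤
      ⨆ i ∈ Set.range c, MeasurableSpace.comap (fun x : ι → X => x i) inferInstance := by
  simp only [MeasurableSpace.pi, MeasurableSpace.comap_iSup, MeasurableSpace.comap_comp]
  exact iSup_le fun i => le_iSup₂_of_le (c i) ⟨i, rfl⟩ le_rfl

/-- Under a product measure, blocks of coordinates with disjoint index sets are independent. -/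
theorem indepFun_infinitePi_of_disjoint {ι α β : Type*} {X : Type*} [MeasurableSpace X]
    (μ : ι → Measure X) [∀ i, IsProbabilityMeasure (μ i)] (a : α → ι) (b : β → ι)
    (hab : Disjoint (Set.range a) (Set.range b)) :
    IndepFun (fun (x : ι → X) i => x (a i)) (fun (x : ι → X) j => x (b j))
      (Measure.infinitePi μ) := by
  have hi : iIndepFun (fun i (x : ι → X) => x i) (Measure.infinitePi μ) :=
    iIndepFun_infinitePi (X := fun _ x => x) (fun _ => measurable_id)
  have key := indep_iSup_of_disjoint (fun i => (measurable_pi_apply i).comap_le) hi hab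
  rw [IndepFun_iff_Indep]
  exact indep_of_indep_of_le_left (indep_of_indep_of_le_right key (comap_reindex_le b))
    (comap_reindex_le a)

/-- Reindexing along the injection `List.cons k` preserves the product measure, so the subtree
labels below a child carry a copy of the whole tree. -/
theorem measureReal_shift_totalProgeny_eq (k n : ℕ) :
    (Measure.infinitePi (fun _ : List ℕ => f.toMeasure)).real
      {x | totalProgeny (fun w => x (k :: w)) = n} = progenyProb f n := by
  have h := Measure.map_infinitePi_infinitePi_of_inj (P := fun _ : List ℕ => f.toMeasure)
    (List.cons_injective (a := k))
  have h2 := map_measureReal_apply (μ := Measure.infinitePi (fun _ : List ℕ => f.toMeasure))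
    (f := fun x w => x (k :: w)) (by fun_prop) (measurableSet_totalProgeny_eq n)
  rw [h] at h2
  exact h2.symm

theorem measureReal_two_shifts (i j : ℕ) :
    (Measure.infinitePi (fun _ : List ℕ => f.toMeasure)).real
      {x | totalProgeny (fun w => x (0 :: w)) = i ∧ totalProgeny (fun w => x (1 :: w)) = j} =
      progenyProb f i * progenyProb f j := by
  have hI := indepFun_infinitePi_of_disjoint (fun _ : List ℕ => f.toMeasure)
    (List.cons 0) (List.cons 1) (by
      rw [Set.disjoint_left]; rintro _ ⟨u, rfl⟩ ⟨v, hv⟩; simp at hv)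
  have := congrArg ENNReal.toReal (hI.measure_inter_preimage_eq_mul _ _ (measurableSet_totalProgeny_eq i)
    (measurableSet_totalProgeny_eq j))
  rw [ENNReal.toReal_mul] at this
  rw [← measureReal_shift_totalProgeny_eq f 0 i, ← measureReal_shift_totalProgeny_eq f 1 j]
  exact this

/-- The root coordinate is independent of all the others. Indexing the latter by child and label
lets one statement serve every offspring number of the root. -/
theorem measureReal_root_inter (k : ℕ) {E : Set (ℕ × List ℕ → ℕ)} (hE : MeasurableSet E) :
    (Measure.infinitePi (fun _ : List ℕ => f.toMeasure)).real
      {x | x [] = k ∧ (fun p : ℕ × List ℕ => x (p.1 :: p.2)) ∈ E} =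
      (f k).toReal * (Measure.infinitePi (fun _ : List ℕ => f.toMeasure)).real
        {x | (fun p : ℕ × List ℕ => x (p.1 :: p.2)) ∈ E} := by
  have hI := indepFun_infinitePi_of_disjoint (fun _ : List ℕ => f.toMeasure)
    (fun _ : Unit => ([] : List ℕ)) (fun p : ℕ × List ℕ => p.1 :: p.2) (by
      rw [Set.disjoint_left]; rintro _ ⟨u, rfl⟩ ⟨v, hv⟩; simp at hv)
  have hk : MeasurableSet {y : Unit → ℕ | y () = k} :=
    measurableSet_eq_fun (measurable_pi_apply ()) measurable_const
  have := congrArg ENNReal.toReal (hI.measure_inter_preimage_eq_mul _ _ hk hE)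
  rw [ENNReal.toReal_mul] at this
  have hr : (Measure.infinitePi (fun _ : List ℕ => f.toMeasure)).real {x | x [] = k} =
      (f k).toReal := by
    have h1 : (Measure.infinitePi (fun _ : List ℕ => f.toMeasure)).map (fun x => x []) =
        f.toMeasure := Measure.infinitePi_map_eval _ _
    have h2 := map_measureReal_apply
      (μ := Measure.infinitePi (fun _ : List ℕ => f.toMeasure))
      (measurable_pi_apply ([] : List ℕ)) (measurableSet_singleton k)
    rw [h1, measureReal_def, PMF.toMeasure_apply_singleton _ _ (measurableSet_singleton k)] at h2
    exact h2.symm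
  rw [← hr]
  exact this

theorem progenyProb_succ (hf : f.support ⊆ {0, 1, 2}) (n : ℕ) :
    progenyProb f (n + 1) = (f 0).toReal * (if n = 0 then 1 else 0) +
      (f 1).toReal * progenyProb f n +
      (f 2).toReal * ∑ p ∈ Finset.HasAntidiagonal.antidiagonal n, progenyProb f p.1 * progenyProb f p.2 := by
  set μ := Measure.infinitePi (fun _ : List ℕ => f.toMeasure) with hμ
  have hm : ∀ k m : ℕ, MeasurableSet
      {y : ℕ × List ℕ → ℕ | totalProgeny (fun w => y (k, w)) = m} := fun k m =>
    (show Measurable (fun (y : ℕ × List ℕ → ℕ) (w : List ℕ) => y (k, w)) by fun_prop)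
      (measurableSet_totalProgeny_eq m)
  have hE2 : ∀ n : ℕ, {y : ℕ × List ℕ → ℕ | totalProgeny (fun w => y (0, w)) +
      totalProgeny (fun w => y (1, w)) = n} = ⋃ p ∈ Finset.HasAntidiagonal.antidiagonal n,
        {y | totalProgeny (fun w => y (0, w)) = (p.1 : ℕ)} ∩
        {y | totalProgeny (fun w => y (1, w)) = (p.2 : ℕ)} := by
    intro n
    ext y
    simp only [Set.mem_ofPred_eq, Set.mem_iUnion, Set.mem_inter_iff, Finset.HasAntidiagonal.mem_antidiagonal,
      exists_prop, Prod.exists]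
    generalize totalProgeny (fun w => y (0, w)) = A
    generalize totalProgeny (fun w => y (1, w)) = B
    constructor
    · intro h
      have hA : A ≠ ⊤ := by rintro rfl; simp at h
      have hB : B ≠ ⊤ := by rintro rfl; simp at h
      lift A to ℕ using hA
      lift B to ℕ using hB
      exact ⟨A, B, by exact_mod_cast h, rfl, rfl⟩
    · rintro ⟨a, b, h, rfl, rfl⟩
      exact_mod_cast h
  have hE2m : MeasurableSet {y : ℕ × List ℕ → ℕ | totalProgeny (fun w => y (0, w)) +
      totalProgeny (fun w => y (1, w)) = n} := by
    rw [hE2]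
    exact Finset.measurableSet_biUnion _ fun p _ => (hm _ _).inter (hm _ _)
  -- For a childless root the event is constant: everything if n = 0, empty otherwise.
  have h0 := measureReal_root_inter f 0 (E := {_y | n = 0}) (by simp)
  have h1 := measureReal_root_inter f 1 (hm 0 n)
  have h2 := measureReal_root_inter f 2 hE2m
  have hroot : ∀ k : ℕ, MeasurableSet {x : List ℕ → ℕ | x [] = k} := fun k =>
    measurableSet_eq_fun (measurable_pi_apply _) measurable_const
  have htail : Measurable (fun (x : List ℕ → ℕ) (p : ℕ × List ℕ) => x (p.1 :: p.2)) := by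
    fun_prop
  have hae : ∀ᵐ x ∂μ, x [] ∈ ({0, 1, 2} : Set ℕ) := by
    have h1 : μ.map (fun x => x []) = f.toMeasure := Measure.infinitePi_map_eval _ _
    have h2 : ∀ᵐ k ∂(μ.map (fun x => x [])), k ∈ ({0, 1, 2} : Set ℕ) := by
      rw [h1]
      have h3 : f.toMeasure ({0, 1, 2} : Set ℕ)ᶜ = 0 := by
        rw [PMF.toMeasure_apply_eq_zero_iff f (MeasurableSet.of_discrete)]
        exact Set.disjoint_left.2 fun x hx hx' => hx' (hf hx)
      exact h3
    exact ae_of_ae_map (measurable_pi_apply _).aemeasurable h2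
  -- The support condition bounds the root's offspring number only almost surely, hence an a.e.
  -- equality.
  have hsplit : {x | totalProgeny x = ((n + 1 : ℕ) : ℕ∞)} =ᵐ[μ]
      (({x | x [] = 0 ∧ n = 0} ∪
      {x | x [] = 1 ∧ totalProgeny (fun w => x (0 :: w)) = n}) ∪
      {x | x [] = 2 ∧ totalProgeny (fun w => x (0 :: w)) + totalProgeny (fun w => x (1 :: w)) = n}
        : Set (List ℕ → ℕ)) := by
    have hcancel : ∀ a : ℕ∞, a + 1 = ((n + 1 : ℕ) : ℕ∞) ↔ a = n := fun a => by
      induction a using ENat.recTopCoe with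
      | top =>
        rw [top_add]
        exact iff_of_false (ENat.natCast_ne_top _).symm (ENat.natCast_ne_top n).symm
      | coe a => norm_cast; omega
    filter_upwards [hae] with x hx
    refine propext (?_ : totalProgeny x = ((n + 1 : ℕ) : ℕ∞) ↔
      (x [] = 0 ∧ n = 0 ∨ x [] = 1 ∧ totalProgeny (fun w => x (0 :: w)) = n) ∨
      x [] = 2 ∧ totalProgeny (fun w => x (0 :: w)) + totalProgeny (fun w => x (1 :: w)) = n)
    rcases hx with h | h | h
    · rw [totalProgeny_of_zero h, h]
      norm_cast
      simp [eq_comm]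
    · rw [totalProgeny_of_one h, h, hcancel]; simp
    · rw [totalProgeny_of_two h, h, hcancel]; simp
  have hm1 : MeasurableSet {x : List ℕ → ℕ | x [] = 1 ∧
      totalProgeny (fun w => x (0 :: w)) = n} := (hroot 1).inter (htail (hm 0 n))
  have hm2 : MeasurableSet {x : List ℕ → ℕ | x [] = 2 ∧
      totalProgeny (fun w => x (0 :: w)) + totalProgeny (fun w => x (1 :: w)) = n} :=
    (hroot 2).inter (htail hE2m)
  have hpair : μ.real {x | totalProgeny (fun w => x (0 :: w)) +
      totalProgeny (fun w => x (1 :: w)) = n} =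
      ∑ p ∈ Finset.HasAntidiagonal.antidiagonal n, progenyProb f p.1 * progenyProb f p.2 := by
    have : {x : List ℕ → ℕ | totalProgeny (fun w => x (0 :: w)) +
        totalProgeny (fun w => x (1 :: w)) = n} =
        ⋃ p ∈ Finset.HasAntidiagonal.antidiagonal n,
          {x | totalProgeny (fun w => x (0 :: w)) = (p.1 : ℕ) ∧
            totalProgeny (fun w => x (1 :: w)) = (p.2 : ℕ)} := by
      have h := congrArg (fun E => (fun (x : List ℕ → ℕ) (p : ℕ × List ℕ) => x (p.1 :: p.2)) ⁻¹' E)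
        (hE2 n)
      simp only [Set.preimage_iUnion] at h
      exact h
    rw [this, measureReal_biUnion_finset]
    · exact Finset.sum_congr rfl fun p _ => measureReal_two_shifts f p.1 p.2
    · intro p _ q _ hpq
      rw [Function.onFun, Set.disjoint_left]
      rintro x ⟨h1, h2⟩ ⟨h3, h4⟩
      exact hpq (Prod.ext (by exact_mod_cast h1.symm.trans h3) (by exact_mod_cast h2.symm.trans h4))
    · exact fun p _ => htail ((hm 0 p.1).inter (hm 1 p.2))
  rw [progenyProb, ← hμ, measureReal_congr hsplit, measureReal_union _ hm2,
    measureReal_union _ hm1]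
  · refine congrArg₂ (· + ·) (congrArg₂ (· + ·) (h0.trans ?_) (h1.trans ?_)) (h2.trans ?_)
    · by_cases hn : n = 0 <;> simp [hn]
    · rw [← measureReal_shift_totalProgeny_eq f 0 n]
      rfl
    · rw [← hpair]
      rfl
  · rw [Set.disjoint_left]
    rintro x ⟨h, -⟩ ⟨h', -⟩
    omega
  · rw [Set.disjoint_left]
    rintro x (⟨h, -⟩ | ⟨h, -⟩) ⟨h', -⟩ <;> omega

/-! ### Formal square roots and explicit coefficients -/

open PowerSeries

/-- The Taylor coefficients of `√(1 - x)` at `0`. -/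
def sqrtCoeff : ℕ → ℝ
  | 0 => 1
  | n + 1 => sqrtCoeff n * ((n : ℝ) - 1 / 2) / (n + 1)

theorem sqrtCoeff_succ (n : ℕ) :
    sqrtCoeff (n + 1) =
      -(Real.Gamma ((n : ℝ) + 1 / 2) / (2 * √Real.pi * Real.Gamma ((n : ℝ) + 2))) := by
  have hpi : √Real.pi ≠ 0 := (Real.sqrt_pos.2 Real.pi_pos).ne'
  induction n with
  | zero =>
    have h2 : Real.Gamma 2 = 1 := by simp
    have h1 := Real.Gamma_one_half_eq
    norm_num [sqrtCoeff, h2] at h1 ⊢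
    rw [h1]
    field_simp
  | succ n ih =>
    rw [sqrtCoeff, ih]
    have e1 : Real.Gamma (((n + 1 : ℕ) : ℝ) + 1 / 2) =
        ((n : ℝ) + 1 / 2) * Real.Gamma ((n : ℝ) + 1 / 2) := by
      rw [← Real.Gamma_add_one (by positivity)]
      push_cast; ring_nf
    have e2 : Real.Gamma (((n + 1 : ℕ) : ℝ) + 2) =
        ((n : ℝ) + 2) * Real.Gamma ((n : ℝ) + 2) := by
      rw [← Real.Gamma_add_one (by positivity)]
      push_cast; ring_nf
    have h2 : Real.Gamma ((n : ℝ) + 2) ≠ 0 := (Real.Gamma_pos_of_pos (by positivity)).ne'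
    rw [e1, e2]
    push_cast
    field_simp
    ring

/-- The formal power series `√(1 - X)`. -/
def sqrtSeries : ℝ⟦X⟧ := PowerSeries.mk sqrtCoeff

theorem one_sub_X_mul_derivative_sqrtSeries :
    (1 - X) * (d⁄dX ℝ sqrtSeries) = -C (1 / 2 : ℝ) * sqrtSeries := by
  ext n
  rw [sub_mul, one_mul, map_sub, neg_mul, map_neg, coeff_C_mul]
  cases n with
  | zero => simp [coeff_derivative, sqrtSeries, sqrtCoeff]
  | succ n =>
    rw [mul_comm X, coeff_succ_mul_X, coeff_derivative, coeff_derivative]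
    simp only [sqrtSeries, coeff_mk]
    rw [sqrtCoeff]
    push_cast
    field_simp
    ring

/-- The equation (1 - X)S' = -S/2 gives (1 - X)T' = -T for T = S², that is, (n + 1)t_{n+1} = (n -
1)t_n. Starting from 1 this yields -1, and the factor n - 1 kills every later coefficient. -/
theorem sqrtSeries_sq : sqrtSeries ^ 2 = 1 - X := by
  set T := sqrtSeries ^ 2 with hT
  have hode : (1 - X) * (d⁄dX ℝ T) = -T := by
    have : d⁄dX ℝ T = 2 * sqrtSeries * d⁄dX ℝ sqrtSeries := by
      rw [hT, pow_two, Derivation.leibniz, smul_eq_mul]; ring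
    rw [this]
    have hC : (2 : ℝ⟦X⟧) * C (1 / 2 : ℝ) = 1 := by
      have : (2 : ℝ⟦X⟧) = C (2 : ℝ) := (map_ofNat C 2).symm
      rw [this, ← map_mul]; norm_num
    linear_combination 2 * sqrtSeries * one_sub_X_mul_derivative_sqrtSeries
      - sqrtSeries ^ 2 * hC + hT
  have hrec : ∀ n : ℕ, coeff (n + 1) T * (n + 1) = (n - 1) * coeff n T := by
    intro n
    have h := congrArg (coeff n) hode
    rw [sub_mul, one_mul, map_sub, map_neg, coeff_derivative] at h
    cases n with
    | zero =>
      rw [coeff_zero_X_mul] at h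
      push_cast at h ⊢
      linarith
    | succ n =>
      rw [mul_comm X, coeff_succ_mul_X, coeff_derivative] at h
      push_cast at h ⊢
      linarith
  have h0 : coeff 0 T = 1 := by
    rw [hT]
    simp [sqrtSeries, sqrtCoeff]
  have h1 : coeff 1 T = -1 := by
    have := hrec 0
    simp only [Nat.cast_zero, h0] at this
    linarith
  have h2 : ∀ n : ℕ, coeff (n + 2) T = 0 := by
    intro n
    induction n with
    | zero =>
      have := hrec 1
      norm_num at this
      simpa using this
    | succ n ih =>
      have := hrec (n + 2)
      rw [ih, mul_zero] at this
      rcases mul_eq_zero.1 this with h | h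
      · exact h
      · exact absurd h (by positivity)
  ext n
  match n with
  | 0 => simp [h0]
  | 1 => simp [h1, coeff_one]
  | n + 2 => rw [h2 n]; simp [coeff_one, coeff_X]

/-- The formal square root of `(1 - uX)(1 - vX)` with constant term `1` is unique. -/
theorem eq_rescale_sqrtSeries_mul {u v : ℝ} {B : ℝ⟦X⟧} (h0 : coeff 0 B = 1)
    (hB : B ^ 2 = (1 - C u * X) * (1 - C v * X)) :
    B = rescale u sqrtSeries * rescale v sqrtSeries := by
  have hs : ∀ a : ℝ, (rescale a sqrtSeries) ^ 2 = 1 - C a * X := fun a => by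
    rw [← map_pow, sqrtSeries_sq, map_sub, map_one, rescale_X]
  have hsq : B ^ 2 = (rescale u sqrtSeries * rescale v sqrtSeries) ^ 2 := by
    rw [mul_pow, hs, hs, hB]
  -- Real power series form a domain, so the roots agree up to sign; the constant term 1 excludes
  -- the minus sign.
  rcases sq_eq_sq_iff_eq_or_eq_neg.1 hsq with h | h
  · exact h
  · exfalso
    have := congrArg (coeff 0) h
    rw [h0] at this
    have hc : ∀ a : ℝ, coeff 0 (rescale a sqrtSeries) = 1 := fun a => by
      rw [coeff_rescale, sqrtSeries, coeff_mk]; simp [sqrtCoeff]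
    simp only [coeff_zero_eq_constantCoeff] at hc this
    rw [map_neg, map_mul, hc, hc] at this
    norm_num at this

/-- The solution of the formal equation `G = X (a + b G + c G²)`. -/
theorem coeff_formal_solution {a b c u v : ℝ} (hadd : u + v = 2 * b)
    (hmul : u * v = b ^ 2 - 4 * a * c) {p : ℕ → ℝ} (h0 : p 0 = 0)
    (hrec : ∀ n, p (n + 1) = a * (if n = 0 then 1 else 0) + b * p n +
      c * ∑ k ∈ Finset.HasAntidiagonal.antidiagonal n, p k.1 * p k.2) (n : ℕ) (hn : 1 ≤ n) :
    -(2 * c) * p n = ∑ k ∈ Finset.HasAntidiagonal.antidiagonal (n + 1),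
      (u ^ k.1 * sqrtCoeff k.1) * (v ^ k.2 * sqrtCoeff k.2) := by
  set G : ℝ⟦X⟧ := PowerSeries.mk p with hG
  have hGeq : G = (C a + C b * G + C c * (G * G)) * X := by
    ext n
    cases n with
    | zero => simp [hG, h0]
    | succ n =>
      rw [coeff_succ_mul_X, map_add, map_add, coeff_C_mul, coeff_C_mul, coeff_mul, coeff_C]
      simp only [hG, coeff_mk, hrec n, mul_ite, mul_one, mul_zero]
  set B : ℝ⟦X⟧ := 1 - C b * X - C (2 * c) * (G * X) with hB
  have hB0 : coeff 0 B = 1 := by simp [hB]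
  have hadd' : C u + C v = 2 * C b := by
    rw [← map_add, hadd, map_mul, map_ofNat]
  have hmul' : C u * C v = C b ^ 2 - 4 * C a * C c := by
    rw [← map_mul, hmul]; simp only [map_sub, map_mul, map_pow, map_ofNat]
  have hc2 : (C (2 * c) : ℝ⟦X⟧) = 2 * C c := by rw [map_mul, map_ofNat]
  have hsq : B ^ 2 = (1 - C u * X) * (1 - C v * X) := by
    rw [hB, hc2]
    linear_combination (-4 * C c * X) * hGeq + X * hadd' - X ^ 2 * hmul'
  have key := congrArg (coeff (n + 1)) (eq_rescale_sqrtSeries_mul hB0 hsq)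
  rw [coeff_mul] at key
  simp only [coeff_rescale, sqrtSeries, coeff_mk] at key
  rw [← key, hB, map_sub, map_sub, coeff_C_mul, coeff_C_mul, coeff_succ_mul_X, coeff_one, coeff_X]
  -- As n ≥ 1, the index n + 1 lies beyond the polynomial part 1 - bX of `B`.
  simp [hG, show n ≠ 0 by omega]

/-- The two end terms contain `sqrtCoeff 0 = 1` and give the pure powers. In the interior terms the
minus signs cancel and the constants combine to 1/(2√π)² = 1/(4π). -/
theorem sum_antidiagonal_sqrtCoeff (u v : ℝ) (n : ℕ) :
    ∑ k ∈ Finset.HasAntidiagonal.antidiagonal (n + 1),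
      (u ^ k.1 * sqrtCoeff k.1) * (v ^ k.2 * sqrtCoeff k.2) =
    -(1 / (2 * √Real.pi) * (Real.Gamma ((n : ℝ) + 1 / 2) / Real.Gamma ((n : ℝ) + 2)) *
              (u ^ (n + 1) + v ^ (n + 1))) +
      1 / (4 * Real.pi) * ∑ j ∈ Finset.Icc 1 n,
    Real.Gamma ((j : ℝ) - 1 / 2) / Real.Gamma ((j : ℝ) + 1) *
      (Real.Gamma ((n : ℝ) - j + 1 / 2) / Real.Gamma ((n : ℝ) - j + 2)) *
      u ^ j * v ^ (n + 1 - j) := by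
  have hpi : √Real.pi ≠ 0 := (Real.sqrt_pos.2 Real.pi_pos).ne'
  have hpi2 : √Real.pi ^ 2 = Real.pi := Real.sq_sqrt Real.pi_pos.le
  rw [Finset.Nat.sum_antidiagonal_eq_sum_range_succ
    (fun i j => (u ^ i * sqrtCoeff i) * (v ^ j * sqrtCoeff j)), Finset.sum_range_succ,
    Finset.sum_range_succ']
  have hS : ∑ i ∈ Finset.range n, (u ^ (i + 1) * sqrtCoeff (i + 1)) *
      (v ^ (n + 1 - (i + 1)) * sqrtCoeff (n + 1 - (i + 1))) =
      1 / (4 * Real.pi) * ∑ j ∈ Finset.Icc 1 n,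
    Real.Gamma ((j : ℝ) - 1 / 2) / Real.Gamma ((j : ℝ) + 1) *
      (Real.Gamma ((n : ℝ) - j + 1 / 2) / Real.Gamma ((n : ℝ) - j + 2)) *
      u ^ j * v ^ (n + 1 - j) := by
    rw [Finset.mul_sum, Finset.range_eq_Ico, Finset.sum_Ico_add'
      (fun i => (u ^ i * sqrtCoeff i) * (v ^ (n + 1 - i) * sqrtCoeff (n + 1 - i))) 0 n 1, zero_add,
      Finset.Ico_add_one_right_eq_Icc]
    refine Finset.sum_congr rfl fun j hj => ?_
    obtain ⟨h1, h2⟩ := Finset.mem_Icc.1 hj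
    obtain ⟨i, rfl⟩ := Nat.exists_eq_add_of_le' h1
    obtain ⟨k, rfl⟩ := Nat.exists_eq_add_of_le h2
    rw [show i + 1 + k + 1 - (i + 1) = k + 1 by omega, sqrtCoeff_succ, sqrtCoeff_succ]
    have e1 : ((i + 1 + k : ℕ) : ℝ) - ((i + 1 : ℕ) : ℝ) = k := by push_cast; ring
    rw [e1]
    push_cast
    rw [show (i : ℝ) + 1 - 1 / 2 = i + 1 / 2 by ring, show (i : ℝ) + 1 + 1 = i + 2 by ring]
    have g1 : Real.Gamma ((i : ℝ) + 2) ≠ 0 := (Real.Gamma_pos_of_pos (by positivity)).ne'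
    have g2 : Real.Gamma ((k : ℝ) + 2) ≠ 0 := (Real.Gamma_pos_of_pos (by positivity)).ne'
    generalize √Real.pi = s at hpi hpi2 ⊢
    rw [← hpi2]
    field_simp
    ring
  rw [hS]
  generalize 1 / (4 * Real.pi) * ∑ j ∈ Finset.Icc 1 n, _ = S
  simp only [Nat.sub_zero, Nat.sub_self, sqrtCoeff_succ, pow_zero]
  rw [show sqrtCoeff 0 = 1 from rfl]
  have g1 : Real.Gamma ((n : ℝ) + 2) ≠ 0 := (Real.Gamma_pos_of_pos (by positivity)).ne'
  field_simp
  ring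

/-! ### The generating function on [-1, 1] -/

section GeneratingFunction

variable {a b c : ℝ} {p : ℕ → ℝ}

theorem norm_mul_pow_le (hp : ∀ n, 0 ≤ p n) {z : ℝ} (hz : |z| ≤ 1) (n : ℕ) :
    ‖p n * z ^ n‖ ≤ p n := by
  rw [norm_mul, norm_pow, Real.norm_of_nonneg (hp n), Real.norm_eq_abs]
  exact mul_le_of_le_one_right (hp n) (pow_le_one₀ (abs_nonneg z) hz)

theorem summable_norm_mul_pow (hp : ∀ n, 0 ≤ p n) (hs : Summable p) {z : ℝ} (hz : |z| ≤ 1) :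
    Summable fun n => ‖p n * z ^ n‖ :=
  hs.of_nonneg_of_le (fun _ => norm_nonneg _) (norm_mul_pow_le hp hz)

theorem continuousOn_tsum_mul_pow (hp : ∀ n, 0 ≤ p n) (hs : Summable p) :
    ContinuousOn (fun z : ℝ => ∑' n, p n * z ^ n) (Set.Icc (-1) 1) :=
  continuousOn_tsum (fun n => by fun_prop) hs fun n _ hz => norm_mul_pow_le hp (abs_le.2 hz) n

/-- Multiply the recursion by z^(n+1) and sum; absolute convergence turns the convolution into a
Cauchy product. -/
theorem tsum_mul_pow_eq (hp : ∀ n, 0 ≤ p n) (hs : Summable p) (h0 : p 0 = 0)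
    (hrec : ∀ n, p (n + 1) = a * (if n = 0 then 1 else 0) + b * p n +
      c * ∑ k ∈ Finset.HasAntidiagonal.antidiagonal n, p k.1 * p k.2) {z : ℝ} (hz : |z| ≤ 1) :
    ∑' n, p n * z ^ n =
      z * (a + b * ∑' n, p n * z ^ n + c * (∑' n, p n * z ^ n) ^ 2) := by
  have hsn := summable_norm_mul_pow hp hs hz
  have hsum := hsn.of_norm
  have hsq := tsum_mul_tsum_eq_tsum_sum_antidiagonal_of_summable_norm hsn hsn
  have hsqs := (summable_norm_sum_mul_antidiagonal_of_summable_norm hsn hsn).of_norm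
  have hone : HasSum (fun n : ℕ => (if n = 0 then (1 : ℝ) else 0)) 1 := by
    simpa using hasSum_ite_eq (0 : ℕ) (1 : ℝ)
  have key := (((hone.mul_left a).add (hsum.hasSum.mul_left b)).add
    (hsqs.hasSum.mul_left c)).mul_left z
  rw [← hsq] at key
  have hval := hsum.tsum_eq_zero_add
  rw [h0, zero_mul, zero_add] at hval
  refine hval.trans (Eq.trans (tsum_congr fun n => ?_) (key.tsum_eq.trans (by ring)))
  have hanti : ∑ k ∈ Finset.HasAntidiagonal.antidiagonal n, p k.1 * z ^ k.1 * (p k.2 * z ^ k.2) =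
      z ^ n * ∑ k ∈ Finset.HasAntidiagonal.antidiagonal n, p k.1 * p k.2 := by
    rw [Finset.mul_sum]
    refine Finset.sum_congr rfl fun k hk => ?_
    rw [← Finset.HasAntidiagonal.mem_antidiagonal.1 hk, pow_add]
    ring
  rw [hrec, hanti]
  by_cases hn : n = 0
  · subst hn; simp; ring
  · simp [hn]; ring

/-- Since a + c = 1 - b, 1 - bz exceeds (a + c)|z| when |z| < 1, and (a + c)² ≥ 4ac. -/
theorem discriminant_pos (ha : 0 ≤ a) (hb : 0 ≤ b) (hc : 0 ≤ c) (habc : a + b + c = 1)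
    {z : ℝ} (hz : |z| < 1) : 0 < (1 - b * z) ^ 2 - 4 * a * c * z ^ 2 := by
  have h1 : (a + c) * |z| < 1 - b * z := by
    have : b * z ≤ b * |z| := mul_le_mul_of_nonneg_left (le_abs_self z) hb
    have : (a + c) * |z| = |z| - b * |z| := by linear_combination |z| * habc
    linarith
  have h2 : ((a + c) * |z|) ^ 2 < (1 - b * z) ^ 2 :=
    pow_lt_pow_left₀ h1 (by positivity) two_ne_zero
  rw [mul_pow, sq_abs] at h2
  nlinarith [mul_nonneg (sq_nonneg (a - c)) (sq_nonneg z)]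

/-- The quadratic equation for the generating function is solved by the branch of the square root
that is positive at `0`. -/
theorem sqrt_discriminant_eq (ha : 0 ≤ a) (hb : 0 ≤ b) (hc : 0 ≤ c) (habc : a + b + c = 1)
    (hp : ∀ n, 0 ≤ p n) (hs : Summable p) (h0 : p 0 = 0)
    (hrec : ∀ n, p (n + 1) = a * (if n = 0 then 1 else 0) + b * p n +
      c * ∑ k ∈ Finset.HasAntidiagonal.antidiagonal n, p k.1 * p k.2) {z : ℝ} (hz : |z| ≤ 1) :
    √((1 - b * z) ^ 2 - 4 * a * c * z ^ 2) = 1 - b * z - 2 * c * z * ∑' n, p n * z ^ n := by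
  set G : ℝ → ℝ := fun z => ∑' n, p n * z ^ n with hG
  have hcont : ContinuousOn (fun z => 1 - b * z - 2 * c * z * G z) (Set.Icc (-1) 1) := by
    have := continuousOn_tsum_mul_pow hp hs
    fun_prop
  have hcont' : ContinuousOn (fun z => √((1 - b * z) ^ 2 - 4 * a * c * z ^ 2))
      (Set.Icc (-1) 1) := by fun_prop
  have hopen : Set.EqOn (fun z => 1 - b * z - 2 * c * z * G z)
      (fun z => √((1 - b * z) ^ 2 - 4 * a * c * z ^ 2)) (Set.Ioo (-1) 1) := by
    -- Two continuous functions with equal squares, one of them nonvanishing on an interval, agree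
    -- once they agree at a point, here 0.
    refine isPreconnected_Ioo.eq_of_sq_eq (hcont.mono Set.Ioo_subset_Icc_self)
      (hcont'.mono Set.Ioo_subset_Icc_self) (fun x hx => ?_) (fun {x} hx => ?_)
      (y := 0) (by norm_num) (by simp)
    · have hx' : |x| < 1 := abs_lt.2 hx
      have hGx : G x = x * (a + b * G x + c * G x ^ 2) := tsum_mul_pow_eq hp hs h0 hrec hx'.le
      change (1 - b * x - 2 * c * x * G x) ^ 2 = (√((1 - b * x) ^ 2 - 4 * a * c * x ^ 2)) ^ 2
      rw [Real.sq_sqrt (discriminant_pos ha hb hc habc hx').le]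
      linear_combination (-4 * c * x) * hGx
    · exact (Real.sqrt_pos.2 (discriminant_pos ha hb hc habc (abs_lt.2 hx))).ne'
  -- The discriminant may vanish at an endpoint, so z = ±1 is reached by continuity.
  have hall := hopen.of_subset_closure hcont hcont' Set.Ioo_subset_Icc_self
    (by rw [closure_Ioo (by norm_num)])
  exact (hall (abs_le.1 hz)).symm

end GeneratingFunction

/-! ### Factorial moments and values at 1 -/

theorem sum_toReal_eq_one {f : PMF ℕ} (hf : f.support ⊆ {0, 1, 2}) :
    (f 0).toReal + (f 1).toReal + (f 2).toReal = 1 := by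
  have h : ∑' n, f n = ∑ n ∈ Finset.range 3, f n := by
    refine tsum_eq_sum fun n hn => ?_
    by_contra hne
    have : n ∈ ({0, 1, 2} : Set ℕ) := hf (f.mem_support_iff n |>.2 hne)
    simp at this hn
    omega
  rw [f.tsum_coe] at h
  have := congrArg ENNReal.toReal h
  rw [ENNReal.toReal_sum (fun n _ => f.apply_ne_top n)] at this
  simp only [Finset.sum_range_succ, Finset.sum_range_zero, zero_add, ENNReal.toReal_one] at this
  exact this.symm

theorem genFun_eq {f : PMF ℕ} (hf : f.support ⊆ {0, 1, 2}) :
    genFun f = fun z => (f 0).toReal + (f 1).toReal * z + (f 2).toReal * z ^ 2 := by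
  funext z
  have h : genFun f z = ∑ n ∈ Finset.range 3, (f n).toReal * z ^ n := by
    refine tsum_eq_sum fun n hn => ?_
    have : f n = 0 := by
      by_contra hne
      have : n ∈ ({0, 1, 2} : Set ℕ) := hf (f.mem_support_iff n |>.2 hne)
      simp at this hn
      omega
    simp [this]
  rw [h]
  simp [Finset.sum_range_succ]

theorem deriv_quadratic (a b c : ℝ) :
    deriv (fun z : ℝ => a + b * z + c * z ^ 2) = fun z => b + 2 * c * z := by
  funext z
  have := (((hasDerivAt_id z).const_mul b).const_add a).add ((hasDerivAt_pow 2 z).const_mul c)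
  refine (HasDerivAt.deriv this).trans ?_
  simp; ring

theorem factorialMoment_one {f : PMF ℕ} (hf : f.support ⊆ {0, 1, 2}) :
    factorialMoment f 1 = (f 1).toReal + 2 * (f 2).toReal := by
  rw [factorialMoment, iteratedDeriv_one, genFun_eq hf, deriv_quadratic]
  simp

theorem factorialMoment_two {f : PMF ℕ} (hf : f.support ⊆ {0, 1, 2}) :
    factorialMoment f 2 = 2 * (f 2).toReal := by
  rw [factorialMoment, iteratedDeriv_succ, iteratedDeriv_one, genFun_eq hf, deriv_quadratic]
  simp

theorem sizeGF_one_of_le {q₁ q₂ : ℝ} (h : q₁ ≤ 1) : sizeGF q₁ q₂ 1 = 1 := by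
  simp [sizeGF, Real.sqrt_sq (sub_nonneg.2 h)]

theorem sizeGF_one_of_lt {q₁ q₂ : ℝ} (h : 1 < q₁) :
    sizeGF q₁ q₂ 1 = 1 - 2 * (q₁ - 1) / q₂ := by
  have : √((1 - q₁) ^ 2) = q₁ - 1 := by
    rw [Real.sqrt_sq_eq_abs, abs_of_neg (by linarith)]; ring
  simp [sizeGF, this]
  ring

end RandomTree

end

theorem mainTheorem6 {Ω : Type*} [MeasurableSpace Ω] (P : Measure Ω) [IsProbabilityMeasure P]
    (Q : ℝ) (hQ : 0 < Q) (f : PMF ℕ) (hf : f.support ⊆ {0, 1, 2}) (hf₂ : f 2 ≠ 0)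
    (τ : List ℕ → Ω → ℝ) (ν : List ℕ → Ω → ℕ) (h : RandomTree.IsEvolution P Q f τ ν)
    (q₁ q₂ : ℝ) (hq₁ : q₁ = RandomTree.factorialMoment f 1)
    (hq₂ : q₂ = RandomTree.factorialMoment f 2) :
    ∃ p : ℕ → ℝ,
      -- the stationary distribution of the tree size
      (∀ n : ℕ, 1 ≤ n →
        Tendsto (fun t : ℝ => P.real {ω | RandomTree.treeSize (τ · ω) (ν · ω) t = n})
          atTop (𝓝 (p n))) ∧
      -- its generating function
      (∀ z : ℝ, |z| ≤ 1 → z ≠ 0 →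
        0 ≤ (1 - q₁ * z) ^ 2 + 2 * q₂ * z * (1 - z) ∧
        RandomTree.sizeGF q₁ q₂ z = z * RandomTree.genFun f (RandomTree.sizeGF q₁ q₂ z) ∧
        HasSum (fun n : ℕ => p (n + 1) * z ^ (n + 1)) (RandomTree.sizeGF q₁ q₂ z)) ∧
      -- the values of the generating function at `0` and `1`
      Tendsto (RandomTree.sizeGF q₁ q₂) (𝓝[≠] 0) (𝓝 0) ∧
      (q₁ ≤ 1 → RandomTree.sizeGF q₁ q₂ 1 = 1) ∧
      (1 < q₁ → RandomTree.sizeGF q₁ q₂ 1 = 1 - 2 * (q₁ - 1) / q₂) ∧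
      -- the explicit probabilities
      (∀ n : ℕ, 1 ≤ n →
        p n = 1 / q₂ *
          (1 / (2 * √Real.pi) * (Real.Gamma ((n : ℝ) + 1 / 2) / Real.Gamma ((n : ℝ) + 2)) *
              (RandomTree.U q₁ q₂ ^ (n + 1) + RandomTree.V q₁ q₂ ^ (n + 1)) -
            RandomTree.W q₁ q₂ n)) ∧
      -- the total mass
      (q₁ ≤ 1 → HasSum (fun n : ℕ => p (n + 1)) 1) ∧
      (1 < q₁ → HasSum (fun n : ℕ => p (n + 1)) (1 - 2 * (q₁ - 1) / q₂)) := by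
  have hp := RandomTree.progenyProb_nonneg f
  have hs := RandomTree.summable_progenyProb f
  have h0 := RandomTree.progenyProb_zero f
  have hrec := RandomTree.progenyProb_succ f hf
  have hlim := RandomTree.tendsto_prob_treeSize P h
  have hgen := RandomTree.genFun_eq hf
  have habc := RandomTree.sum_toReal_eq_one hf
  have hc : 0 < (f 2).toReal := ENNReal.toReal_pos hf₂ (f.apply_ne_top 2)
  rw [RandomTree.factorialMoment_one hf] at hq₁
  rw [RandomTree.factorialMoment_two hf] at hq₂
  have ha : 0 ≤ (f 0).toReal := ENNReal.toReal_nonneg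
  have hb : 0 ≤ (f 1).toReal := ENNReal.toReal_nonneg
  generalize RandomTree.progenyProb f = p at *
  generalize (f 0).toReal = a at *
  generalize (f 1).toReal = b at *
  generalize (f 2).toReal = c at *
  have hq₂0 : q₂ ≠ 0 := by rw [hq₂]; positivity
  -- With q₁ = b + 2c and q₂ = 2c, the two discriminants differ by a multiple of a + b + c - 1.
  have hD : ∀ z : ℝ, (1 - q₁ * z) ^ 2 + 2 * q₂ * z * (1 - z) =
      (1 - b * z) ^ 2 - 4 * a * c * z ^ 2 := fun z => by
    rw [hq₁, hq₂]
    linear_combination 4 * c * z ^ 2 * habc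
  have hsz : ∀ z : ℝ, |z| ≤ 1 → z ≠ 0 → RandomTree.sizeGF q₁ q₂ z = ∑' n, p n * z ^ n := by
    intro z hz hz0
    rw [RandomTree.sizeGF, hD, RandomTree.sqrt_discriminant_eq ha hb hc.le habc hp hs h0 hrec hz,
      hq₁, hq₂]
    field_simp
    ring
  have hsum : ∀ z : ℝ, |z| ≤ 1 → z ≠ 0 →
      HasSum (fun n : ℕ => p (n + 1) * z ^ (n + 1)) (RandomTree.sizeGF q₁ q₂ z) := by
    intro z hz hz0
    rw [hsz z hz hz0]
    have := (RandomTree.summable_norm_mul_pow hp hs hz).of_norm.hasSum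
    rw [← hasSum_nat_add_iff' 1] at this
    simpa [h0] using this
  have hone : HasSum (fun n : ℕ => p (n + 1)) (RandomTree.sizeGF q₁ q₂ 1) := by
    simpa using hsum 1 (by simp) one_ne_zero
  refine ⟨p, fun n _ => hlim n, fun z hz hz0 => ⟨?_, ?_, hsum z hz hz0⟩, ?_,
    RandomTree.sizeGF_one_of_le, RandomTree.sizeGF_one_of_lt, ?_, ?_, ?_⟩
  · have hsqrt := RandomTree.sqrt_discriminant_eq ha hb hc.le habc hp hs h0 hrec hz
    have hG := RandomTree.tsum_mul_pow_eq hp hs h0 hrec hz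
    have : (1 - q₁ * z) ^ 2 + 2 * q₂ * z * (1 - z) =
        (1 - b * z - 2 * c * z * ∑' n, p n * z ^ n) ^ 2 := by
      rw [hD]
      linear_combination (4 * c * z) * hG
    rw [this]
    positivity
  · rw [hsz z hz hz0, hgen]
    exact RandomTree.tsum_mul_pow_eq hp hs h0 hrec hz
  -- `sizeGF` takes the junk value 1 at 0, so its punctured limit is read off from the series, which
  -- is continuous there.
  · have hcont : ContinuousAt (fun z : ℝ => ∑' n, p n * z ^ n) 0 :=
      (RandomTree.continuousOn_tsum_mul_pow hp hs).continuousAt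
        (Icc_mem_nhds (by norm_num) (by norm_num))
    have hval : ∑' n, p n * (0 : ℝ) ^ n = 0 := by
      simpa using RandomTree.tsum_mul_pow_eq hp hs h0 hrec (z := 0) (by simp)
    have ht := hcont.tendsto.mono_left (nhdsWithin_le_nhds (s := {0}ᶜ))
    rw [hval] at ht
    refine ht.congr' ?_
    have hnear : ∀ᶠ z : ℝ in 𝓝[≠] 0, z ∈ Set.Icc (-1 : ℝ) 1 :=
      nhdsWithin_le_nhds (Icc_mem_nhds (by norm_num) (by norm_num))
    filter_upwards [hnear, self_mem_nhdsWithin] with z hz hz0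
    exact (hsz z (abs_le.2 hz) hz0).symm
  · intro n hn
    -- Here 2q₂ = 4c and 1 - q₁ + q₂/2 = a, so the product of roots is 2√(ac).
    have hr : (√(2 * q₂) * √(1 - q₁ + q₂ / 2)) ^ 2 = 4 * a * c := by
      have h1 : 1 - q₁ + q₂ / 2 = a := by rw [hq₁, hq₂]; linarith
      rw [h1, mul_pow, Real.sq_sqrt (by rw [hq₂]; positivity), Real.sq_sqrt ha, hq₂]
      ring
    have hadd : RandomTree.U q₁ q₂ + RandomTree.V q₁ q₂ = 2 * b := by
      rw [RandomTree.U, RandomTree.V, hq₁, hq₂]; ring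
    have hmul : RandomTree.U q₁ q₂ * RandomTree.V q₁ q₂ = b ^ 2 - 4 * a * c := by
      rw [← hr, RandomTree.U, RandomTree.V]
      have : q₁ - q₂ = b := by rw [hq₁, hq₂]; ring
      rw [this]; ring
    have key := RandomTree.coeff_formal_solution hadd hmul h0 hrec n hn
    rw [RandomTree.sum_antidiagonal_sqrtCoeff, ← hq₂] at key
    rw [one_div_mul_eq_div, eq_div_iff hq₂0, RandomTree.W]
    linear_combination -key
  · intro h1
    rwa [RandomTree.sizeGF_one_of_le h1] at hone
  · intro h1
    rwa [RandomTree.sizeGF_one_of_lt h1] at hone
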